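/- For integers $k,n\ge 0$ let $E_n^{(k)}(x)\in\mathbb{Q}[x]$ be the generalized Euler polynomial of order $k$ and degree $n$, defined by \[ \left(\frac{2}{e^t+1}\right)^{k}e^{tx}=\sum_{n=0}^{\infty}E_n^{(k)}(x)\frac{t^n}{n!}, \] and let $B_n$ be the $n$th Bernoulli number, $\frac{t}{e^t-1}=\sum_{n\ge 0}B_n\frac{t^n}{n!}$. A polynomial $f(x)=\sum_{j=0}^{n}a_jx^j\in\mathbb{Q}[x]$ of degree $n$ is said to be in Eisenstein form with respect to a prime $p$ if $\nu_p(a_n)=0$, $\nu_p(a_j)\ge 1$ for $0\le j\le n-1$, and $\nu_p(a_0)=1$, where $\nu_p$ is the $p$-adic valuation on $\mathbb{Q}$ (with $\nu_p(0)=\infty$). Theorem. Let $m$ be an even positive integer and let $p$ be an odd prime. Then $m(2^m-1)B_m$ is an integer, and $E_{mp}^{(mp)}(x)$ is in Eisenstein form with respect to $p$ if and only if $p$ does not divide $m(2^m-1)B_m$. -/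

import Mathlib

open Polynomial

/-- The Maclaurin series of `2 / (e ^ t + 1)`, as a formal power series in `t` over `ℚ`.
The denominator has constant coefficient `2`, so it is invertible
(see `expSeries_add_one_mul_eulerSeries`). -/
noncomputable def eulerSeries : PowerSeries ℚ :=
  2 * (PowerSeries.exp ℚ + 1)⁻¹

/-- `(e ^ t + 1) * (2 / (e ^ t + 1)) = 2`. -/
theorem expSeries_add_one_mul_eulerSeries :
    (PowerSeries.exp ℚ + 1) * eulerSeries = 2 := by
  have h : PowerSeries.constantCoeff (PowerSeries.exp ℚ + 1) ≠ 0 := by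
    rw [map_add, PowerSeries.constantCoeff_exp, map_one]
    norm_num
  rw [eulerSeries, mul_left_comm, PowerSeries.mul_inv_cancel _ h, mul_one]

/-- The generalized Euler polynomial `E_n^{(k)}(x)` of order `k` and degree `n`:
`n!` times the coefficient of `t ^ n` in `(2 / (e ^ t + 1)) ^ k * e ^ (t x)`,
a formal power series in `t` with coefficients in `ℚ[x]`. -/
noncomputable def genEulerPoly (k n : ℕ) : ℚ[X] :=
  (n.factorial : ℚ) •
    PowerSeries.coeff n
      (PowerSeries.map (C : ℚ →+* ℚ[X]) (eulerSeries ^ k) *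
        PowerSeries.rescale (X : ℚ[X]) (PowerSeries.exp ℚ[X]))

/-- `f = ∑ a_j x ^ j`, of degree `n`, is in Eisenstein form with respect to the prime `p`:
`ν_p(a_n) = 0`, `ν_p(a_j) ≥ 1` for `0 ≤ j < n`, and `ν_p(a_0) = 1`. As usual `ν_p(0) = ∞`;
Mathlib's `padicValRat p 0` is `0`, so vanishing lower coefficients are allowed separately. -/
def IsEisensteinForm (p : ℕ) (f : ℚ[X]) : Prop :=
  padicValRat p f.leadingCoeff = 0 ∧
  (∀ j < f.natDegree, f.coeff j = 0 ∨ 1 ≤ padicValRat p (f.coeff j)) ∧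
  padicValRat p (f.coeff 0) = 1

/-!
Write `E = 2 / (e ^ t + 1)` and `e_n = n! [t ^ n] E`. The polynomial `E_n^{(k)}` is monic of degree
`n`, and its coefficient of `x ^ i` is `n.choose i` times the exponential coefficient of `E ^ k` of
index `n - i`, so only `E ^ (m * p)` has to be understood modulo `p ^ 2`.

For odd `p` the series `E` is the exponential generating function of a `p`-integral sequence
(`eulerSeries_mem_egfSubring`). Such series form a ring stable under differentiation, and the
Riccati equation `E' = E ^ 2 / 2 - E` gives
`(E ^ (m * p))' = m * p * (E ^ (m * p) * E / 2 - E ^ (m * p))`.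
Thus `E ^ (m * p)` is `1` modulo `p` (`exists_eulerSeries_pow_eq`), which settles every lower
coefficient. Inserting this back on the right-hand side, the constant term of `E_{mp}^{(mp)}` is
`m * p * e_{mp-1} / 2` modulo `p ^ 2`. By the Kummer congruence
(`exists_egfCoeff_eulerSeries_add_mul`) one may replace `e_{mp-1}` by `e_{m-1}`, as
`mp - m = m (p - 1)`, and `m * e_{m-1} = -2 * (2 ^ m - 1) * B_m`. So the constant term has valuation
one exactly when `b = (2 ^ m - 1) * B_m` is a `p`-adic unit. Since `b = -m * e_{m-1} / 2` is divisible
by `m`, this is equivalent to `m * b` being a unit.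

Integrality of `m * (2 ^ m - 1) * B_m` follows from the von Staudt–Clausen theorem: each prime `q`
with `q - 1 ∣ m` divides `m * (2 ^ m - 1)`, by parity if `q = 2` and by Fermat's theorem otherwise.
-/

/-! ### Exponential generating functions -/

/-- The `n`-th coefficient of `f` as an exponential generating function: `n!` times the coefficient
of `t ^ n`. -/
noncomputable def egfCoeff (n : ℕ) : PowerSeries ℚ →ₗ[ℚ] ℚ :=
  (n.factorial : ℚ) • PowerSeries.coeff n

theorem egfCoeff_apply (n : ℕ) (f : PowerSeries ℚ) :
    egfCoeff n f = n.factorial * PowerSeries.coeff n f := rfl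

theorem egfCoeff_zero_apply (f : PowerSeries ℚ) :
    egfCoeff 0 f = PowerSeries.constantCoeff f := by
  simp [egfCoeff_apply]

theorem egfCoeff_one (n : ℕ) : egfCoeff n 1 = if n = 0 then 1 else 0 := by
  rw [egfCoeff_apply, PowerSeries.coeff_one]
  split_ifs with h <;> simp [h]

theorem egfCoeff_exp_pow (n i : ℕ) : egfCoeff n (PowerSeries.exp ℚ ^ i) = (i : ℚ) ^ n := by
  have h : (n.factorial : ℚ) ≠ 0 := by positivity
  rw [egfCoeff_apply, PowerSeries.exp_pow_eq_rescale_exp, PowerSeries.coeff_rescale,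
    PowerSeries.coeff_exp]
  simp only [eq_ratCast, Rat.cast_id]
  field_simp

theorem egfCoeff_derivative (n : ℕ) (f : PowerSeries ℚ) :
    egfCoeff n (PowerSeries.derivative ℚ f) = egfCoeff (n + 1) f := by
  rw [egfCoeff_apply, egfCoeff_apply, PowerSeries.coeff_derivative, Nat.factorial_succ]
  push_cast
  ring

theorem egfCoeff_mul (n : ℕ) (f g : PowerSeries ℚ) :
    egfCoeff n (f * g) =
      ∑ ij ∈ Finset.HasAntidiagonal.antidiagonal n, (n.choose ij.1 : ℚ) * egfCoeff ij.1 f * egfCoeff ij.2 g := by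
  rw [egfCoeff_apply, PowerSeries.coeff_mul, Finset.mul_sum]
  refine Finset.sum_congr rfl fun ⟨i, j⟩ hij => ?_
  obtain rfl := Finset.HasAntidiagonal.mem_antidiagonal.1 hij
  rw [egfCoeff_apply, egfCoeff_apply]
  dsimp only
  rw [← Nat.add_choose_mul_factorial_mul_factorial i j, Nat.choose_symm_add]
  push_cast
  ring

/-- The subring of power series that are exponential generating functions of sequences in `R`. -/
def egfSubring (R : Subring ℚ) : Subring (PowerSeries ℚ) where
  carrier := {f | ∀ n, egfCoeff n f ∈ R}
  mul_mem' {f g} hf hg n := by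
    rw [egfCoeff_mul]
    exact sum_mem fun ij _ => R.mul_mem (R.mul_mem (natCast_mem R _) (hf _)) (hg _)
  one_mem' n := by
    rw [egfCoeff_one]
    split_ifs
    exacts [R.one_mem, R.zero_mem]
  add_mem' {f g} hf hg n := by
    rw [map_add]
    exact R.add_mem (hf n) (hg n)
  zero_mem' n := by
    rw [map_zero]
    exact R.zero_mem
  neg_mem' {f} hf n := by
    rw [map_neg]
    exact R.neg_mem (hf n)

/-! ### The series `2 / (e ^ t + 1)` and its relation to the Bernoulli numbers -/

theorem constantCoeff_eulerSeries : PowerSeries.constantCoeff eulerSeries = 1 := by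
  have h := congrArg PowerSeries.constantCoeff expSeries_add_one_mul_eulerSeries
  rw [map_mul, map_add, PowerSeries.constantCoeff_exp, map_one, map_ofNat] at h
  linarith

theorem two_mul_C_half : (2 : PowerSeries ℚ) * PowerSeries.C (1 / 2 : ℚ) = 1 := by
  rw [show (2 : PowerSeries ℚ) = PowerSeries.C (2 : ℚ) from rfl, ← map_mul]
  norm_num

theorem exp_add_one_ne_zero : PowerSeries.exp ℚ + 1 ≠ 0 := fun h => by
  have h' := congrArg PowerSeries.constantCoeff h
  rw [map_add, PowerSeries.constantCoeff_exp, map_one, map_zero] at h'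
  norm_num at h'

theorem exp_sub_one_ne_zero : PowerSeries.exp ℚ - 1 ≠ 0 := fun h => by
  have h' := bernoulliPowerSeries_mul_exp_sub_one ℚ
  rw [h, mul_zero] at h'
  exact PowerSeries.X_ne_zero h'.symm

/-- The Riccati equation `E' = E ^ 2 / 2 - E` for `E = 2 / (e ^ t + 1)`. -/
theorem derivative_eulerSeries :
    PowerSeries.derivative ℚ eulerSeries =
      (1 / 2 : ℚ) • eulerSeries ^ 2 - eulerSeries := by
  have hE := expSeries_add_one_mul_eulerSeries
  have hD := congrArg (PowerSeries.derivative ℚ) hE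
  have h2 : PowerSeries.derivative ℚ (2 : PowerSeries ℚ) = 0 :=
    PowerSeries.derivative_C (r := (2 : ℚ))
  rw [Derivation.leibniz, map_add, PowerSeries.derivative_exp, PowerSeries.derivative_one, h2,
    add_zero, smul_eq_mul, smul_eq_mul] at hD
  refine mul_left_cancel₀ exp_add_one_ne_zero ?_
  rw [PowerSeries.smul_eq_C_mul]
  linear_combination hD - eulerSeries * PowerSeries.C (1 / 2 : ℚ) * hE - eulerSeries * two_mul_C_half

theorem derivative_eulerSeries_pow (k : ℕ) :
    PowerSeries.derivative ℚ (eulerSeries ^ k) =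
      (k : ℚ) • ((1 / 2 : ℚ) • (eulerSeries ^ k * eulerSeries) - eulerSeries ^ k) := by
  rcases k with _ | k
  · simp
  · rw [PowerSeries.derivative_pow, derivative_eulerSeries, Nat.add_sub_cancel]
    simp only [PowerSeries.smul_eq_C_mul, map_natCast]
    ring

/-- Up to a power of two, the first Euler numbers `n! [t ^ n] E` are values of one exponential
polynomial `n ↦ ∑ i, q_i * i ^ n` with integer coefficients. It comes from truncating the expansion
`E = ∑ k, (1 - e ^ t) ^ k / 2 ^ k`. -/
theorem exists_two_pow_mul_egfCoeff_eulerSeries (M : ℕ) :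
    ∃ q : ℤ[X], ∀ n ≤ M, (2 : ℚ) ^ M * egfCoeff n eulerSeries =
      ((q.sum fun i a => a * (i : ℤ) ^ n : ℤ) : ℚ) := by
  -- The truncated expansion, with `e ^ t` as the variable, cleared of denominators by `2 ^ M`.
  refine ⟨∑ k ∈ Finset.range (M + 1), (1 - X) ^ k * 2 ^ (M - k), fun n hn => ?_⟩
  set q : ℤ[X] := ∑ k ∈ Finset.range (M + 1), (1 - X) ^ k * 2 ^ (M - k) with hq
  set e := PowerSeries.exp ℚ with he
  have hS : aeval e q * (-(e + 1)) = (1 - e) ^ (M + 1) - 2 ^ (M + 1) := by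
    rw [← Commute.geom_sum₂_mul (Commute.all _ _), hq, map_sum]
    simp only [map_mul, map_pow, map_sub, map_one, aeval_X, map_ofNat, Nat.add_sub_cancel]
    ring
  have h3 : 2 ^ M * eulerSeries - aeval e q =
      (1 / 2 : ℚ) • (eulerSeries * (1 - e) ^ (M + 1)) := by
    rw [PowerSeries.smul_eq_C_mul]
    linear_combination PowerSeries.C (1 / 2 : ℚ) * eulerSeries * hS
      + PowerSeries.C (1 / 2 : ℚ) * aeval e q * expSeries_add_one_mul_eulerSeries
      - (2 ^ M * eulerSeries - aeval e q) * two_mul_C_half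
  have hdvd : (PowerSeries.X : PowerSeries ℚ) ^ (M + 1) ∣
      2 ^ M * eulerSeries - aeval e q := by
    rw [h3, PowerSeries.smul_eq_C_mul]
    refine Dvd.dvd.mul_left (Dvd.dvd.mul_left (pow_dvd_pow_of_dvd ?_ _) _) _
    rw [PowerSeries.X_dvd_iff]
    simp [he]
  have h4 : egfCoeff n (2 ^ M * eulerSeries - aeval e q) = 0 := by
    rw [egfCoeff_apply, PowerSeries.X_pow_dvd_iff.1 hdvd n (by omega), mul_zero]
  have h5 : (2 : PowerSeries ℚ) ^ M * eulerSeries = (2 : ℚ) ^ M • eulerSeries := by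
    rw [PowerSeries.smul_eq_C_mul, map_pow, map_ofNat]
  rw [map_sub, h5, map_smul, smul_eq_mul, sub_eq_zero] at h4
  rw [h4, aeval_def, eval₂_eq_sum_range, map_sum, Polynomial.sum_over_range _ (by simp)]
  push_cast
  refine Finset.sum_congr rfl fun i _ => ?_
  rw [eq_intCast, ← zsmul_eq_mul, map_zsmul, egfCoeff_exp_pow, zsmul_eq_mul]

/-- With `B = t / (e ^ t - 1)`, the difference `B(t) - B(2t)` is `t / (e ^ t + 1)`. -/
theorem two_mul_bernoulliPowerSeries_sub_rescale :
    (2 : PowerSeries ℚ) *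
      (bernoulliPowerSeries ℚ - PowerSeries.rescale 2 (bernoulliPowerSeries ℚ)) =
        PowerSeries.X * eulerSeries := by
  have hB := bernoulliPowerSeries_mul_exp_sub_one ℚ
  have hB2 := congrArg (PowerSeries.rescale (2 : ℚ)) hB
  have he := PowerSeries.exp_pow_eq_rescale_exp (A := ℚ) 2
  rw [Nat.cast_ofNat] at he
  rw [map_mul, map_sub, map_one, ← he, PowerSeries.rescale_X, map_ofNat] at hB2
  have hE := expSeries_add_one_mul_eulerSeries
  refine mul_left_cancel₀ (mul_ne_zero exp_add_one_ne_zero exp_sub_one_ne_zero) ?_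
  linear_combination 2 * (PowerSeries.exp ℚ + 1) * hB - 2 * hB2
    - PowerSeries.X * (PowerSeries.exp ℚ - 1) * hE

theorem succ_mul_egfCoeff_eulerSeries (n : ℕ) :
    ((n + 1 : ℕ) : ℚ) * egfCoeff n eulerSeries =
      -2 * ((2 ^ (n + 1) - 1) * _root_.bernoulli (n + 1)) := by
  have h := congrArg (egfCoeff (n + 1)) two_mul_bernoulliPowerSeries_sub_rescale
  have h2 : ∀ f : PowerSeries ℚ, 2 * f = (2 : ℚ) • f := fun f => by
    rw [PowerSeries.smul_eq_C_mul, map_ofNat]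
  rw [h2, map_smul, egfCoeff_apply, egfCoeff_apply, map_sub, PowerSeries.coeff_rescale,
    bernoulliPowerSeries, PowerSeries.coeff_mk, PowerSeries.coeff_succ_X_mul] at h
  simp only [eq_ratCast, Rat.cast_id, smul_eq_mul] at h
  have hf : ((n + 1).factorial : ℚ) ≠ 0 := by positivity
  field_simp at h
  rw [egfCoeff_apply, ← mul_assoc, ← Nat.cast_mul, ← Nat.factorial_succ, ← h]
  ring

/-! ### Coefficients of the generalized Euler polynomials -/

theorem coeff_genEulerPoly (k n i : ℕ) :
    (genEulerPoly k n).coeff i =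
      if i ≤ n then (n.choose i : ℚ) * egfCoeff (n - i) (eulerSeries ^ k) else 0 := by
  rw [genEulerPoly, coeff_smul, PowerSeries.coeff_mul, finsetSum_coeff]
  have hterm : ∀ a b : ℕ, (PowerSeries.coeff a (PowerSeries.map (C : ℚ →+* ℚ[X]) (eulerSeries ^ k)) *
      PowerSeries.coeff b (PowerSeries.rescale (X : ℚ[X]) (PowerSeries.exp ℚ[X]))).coeff i =
      if i = b then PowerSeries.coeff a (eulerSeries ^ k) * (1 / b.factorial) else 0 := by
    intro a b
    rw [PowerSeries.coeff_map, PowerSeries.coeff_rescale, PowerSeries.coeff_exp,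
      Polynomial.algebraMap_apply, coeff_C_mul, coeff_mul_C, coeff_X_pow]
    split_ifs <;> simp
  simp only [hterm]
  rw [Finset.Nat.sum_antidiagonal_eq_sum_range_succ_mk, ← Finset.sum_range_reflect]
  split_ifs with hi
  · rw [Finset.sum_eq_single_of_mem i (Finset.mem_range.2 (by omega))]
    · rw [if_pos (by omega), show n.succ - 1 - i = n - i by omega, Nat.sub_sub_self hi,
        egfCoeff_apply, ← Nat.choose_mul_factorial_mul_factorial hi, smul_eq_mul]
      have : (i.factorial : ℚ) ≠ 0 := by positivity
      push_cast
      field_simp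
    · intro j hj hji
      rw [Finset.mem_range] at hj
      rw [if_neg (by omega)]
  · rw [Finset.sum_eq_zero, smul_zero]
    intro j hj
    rw [Finset.mem_range] at hj
    rw [if_neg (by omega)]

theorem coeff_genEulerPoly_self (k n : ℕ) : (genEulerPoly k n).coeff n = 1 := by
  rw [coeff_genEulerPoly, if_pos le_rfl, Nat.choose_self, Nat.sub_self, egfCoeff_zero_apply,
    map_pow, constantCoeff_eulerSeries]
  simp

theorem natDegree_genEulerPoly (k n : ℕ) : (genEulerPoly k n).natDegree = n := by
  refine natDegree_eq_of_le_of_coeff_ne_zero ?_ (by simp [coeff_genEulerPoly_self])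
  refine natDegree_le_iff_coeff_eq_zero.2 fun i hi => ?_
  rw [coeff_genEulerPoly, if_neg (by omega)]

/-! ### Congruences modulo an odd prime -/

section Valuation

variable (p : ℕ) [Fact p.Prime]

open WithZero

/-- The ring of `p`-integral rationals, `ℤ` localized at `p`. -/
noncomputable def pIntegers : Subring ℚ := (Rat.padicValuation p).integer

variable {p}

theorem mem_pIntegers {x : ℚ} : x ∈ pIntegers p ↔ Rat.padicValuation p x ≤ 1 := Iff.rfl

theorem padicValuation_of_ne_zero {x : ℚ} (hx : x ≠ 0) :
    Rat.padicValuation p x = exp (-padicValRat p x) := if_neg hx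

theorem padicValuation_two (hp : Odd p) : Rat.padicValuation p 2 = 1 := by
  have h := (Int.padicValuation_eq_one_iff (p := p) (x := 2)).2 ?_
  · simpa using (Rat.padicValuation_cast p 2).trans h
  · intro h
    have h2 : p ∣ 2 := by exact_mod_cast h
    have := (Nat.prime_dvd_prime_iff_eq Fact.out Nat.prime_two).1 h2
    subst this
    exact absurd hp (by decide)

theorem half_mem_pIntegers (hp : Odd p) : (1 / 2 : ℚ) ∈ pIntegers p := by
  rw [mem_pIntegers, map_div₀, padicValuation_two hp, map_one, div_one]

theorem padicValuation_prime_mul_lt_one {x : ℚ} (hx : x ∈ pIntegers p) :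
    Rat.padicValuation p (p * x) < 1 := by
  rw [map_mul, Rat.padicValuation_self]
  calc exp (-1 : ℤ) * Rat.padicValuation p x ≤ exp (-1 : ℤ) * 1 := by gcongr; exact hx
    _ < 1 := by rw [mul_one, ← exp_zero, exp_lt_exp]; norm_num

theorem eq_zero_or_one_le_padicValRat {x : ℚ} (hx : x ∈ pIntegers p) :
    (p * x : ℚ) = 0 ∨ 1 ≤ padicValRat p (p * x) := by
  rw [or_iff_not_imp_left]
  intro h
  have h1 := padicValuation_prime_mul_lt_one hx
  rw [padicValuation_of_ne_zero h, ← exp_zero, exp_lt_exp] at h1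
  omega

theorem padicValRat_prime_mul_eq_one_iff {x : ℚ} :
    padicValRat p (p * x) = 1 ↔ Rat.padicValuation p x = 1 := by
  have hp : (p : ℚ) ≠ 0 := by exact_mod_cast (Fact.out : p.Prime).ne_zero
  rcases eq_or_ne x 0 with rfl | hx
  · simp
  · rw [padicValRat.mul hp hx, padicValRat.self (Fact.out : p.Prime).one_lt,
      padicValuation_of_ne_zero hx, ← exp_zero, exp_inj]
    omega

theorem eulerSeries_mem_egfSubring (hp : Odd p) : eulerSeries ∈ egfSubring (pIntegers p) := by
  intro n
  obtain ⟨q, hq⟩ := exists_two_pow_mul_egfCoeff_eulerSeries n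
  have h : egfCoeff n eulerSeries = (1 / 2) ^ n * (2 ^ n * egfCoeff n eulerSeries) := by
    rw [← mul_assoc, ← mul_pow]
    norm_num
  rw [h, hq n le_rfl]
  exact mul_mem (pow_mem (half_mem_pIntegers hp) n) (intCast_mem _ _)

theorem int_prime_dvd_pow_add_mul_sub_one_sub_pow (a : ℤ) {n : ℕ} (hn : n ≠ 0) (j : ℕ) :
    (p : ℤ) ∣ a ^ (n + j * (p - 1)) - a ^ n := by
  rw [← ZMod.intCast_zmod_eq_zero_iff_dvd]
  push_cast
  rcases eq_or_ne (a : ZMod p) 0 with h | h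
  · rw [h, zero_pow hn, zero_pow (by omega), sub_zero]
  · rw [pow_add, mul_comm j, pow_mul, ZMod.pow_card_sub_one_eq_one h, one_pow, mul_one, sub_self]

/-- The Kummer congruence for the Euler numbers: modulo `p` they depend only on the residue of the
positive index `n` modulo `p - 1`. -/
theorem exists_egfCoeff_eulerSeries_add_mul (hp : Odd p) {n : ℕ} (hn : n ≠ 0) (j : ℕ) :
    ∃ r ∈ pIntegers p, egfCoeff (n + j * (p - 1)) eulerSeries =
      egfCoeff n eulerSeries + p * r := by
  set M := n + j * (p - 1) with hM
  obtain ⟨q, hq⟩ := exists_two_pow_mul_egfCoeff_eulerSeries M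
  have hdvd : (p : ℤ) ∣ (q.sum fun i a => a * (i : ℤ) ^ M) - q.sum fun i a => a * (i : ℤ) ^ n := by
    rw [Polynomial.sum_def, Polynomial.sum_def, ← Finset.sum_sub_distrib]
    refine Finset.dvd_sum fun i _ => ?_
    rw [← mul_sub]
    exact (int_prime_dvd_pow_add_mul_sub_one_sub_pow _ hn j).mul_left _
  obtain ⟨c, hc⟩ := hdvd
  refine ⟨(1 / 2) ^ M * c, mul_mem (pow_mem (half_mem_pIntegers hp) M) (intCast_mem _ _), ?_⟩
  -- The same exponential polynomial represents both coefficients, so Fermat's theorem applies.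
  have h : (2 : ℚ) ^ M * egfCoeff M eulerSeries - 2 ^ M * egfCoeff n eulerSeries = p * c := by
    rw [hq M le_rfl, hq n (by omega)]
    exact_mod_cast hc
  have h2 : (1 / 2 : ℚ) ^ M * 2 ^ M = 1 := by
    rw [← mul_pow]
    norm_num
  linear_combination (1 / 2 : ℚ) ^ M * h -
    (egfCoeff M eulerSeries - egfCoeff n eulerSeries) * h2

theorem half_smul_mem_egfSubring (hp : Odd p) {f : PowerSeries ℚ}
    (hf : f ∈ egfSubring (pIntegers p)) : (1 / 2 : ℚ) • f ∈ egfSubring (pIntegers p) := fun n => by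
  rw [map_smul]
  exact mul_mem (half_mem_pIntegers hp) (hf n)

/-- As `E` is a `p`-integral exponential generating function, so is `E'`, and the derivative of
`E ^ (m * p)` is divisible by `p`. Hence `E ^ (m * p)` is constant modulo `p`. -/
theorem exists_eulerSeries_pow_eq (hp : Odd p) (m : ℕ) :
    ∃ g ∈ egfSubring (pIntegers p), eulerSeries ^ (m * p) = 1 + (p : ℚ) • g := by
  have hp0 : (p : ℚ) ≠ 0 := by exact_mod_cast (Fact.out : p.Prime).ne_zero
  refine ⟨(p : ℚ)⁻¹ • (eulerSeries ^ (m * p) - 1), fun n => ?_, ?_⟩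
  · rcases n with _ | n
    · rw [map_smul, egfCoeff_zero_apply, map_sub, map_pow, constantCoeff_eulerSeries]
      simp [zero_mem]
    · rw [map_smul, map_sub, egfCoeff_one, if_neg n.succ_ne_zero, sub_zero, ← egfCoeff_derivative,
        derivative_eulerSeries_pow, map_smul, smul_smul, Nat.cast_mul, mul_comm (m : ℚ),
        inv_mul_cancel_left₀ hp0, smul_eq_mul]
      have hE := eulerSeries_mem_egfSubring hp
      exact mul_mem (natCast_mem _ _) (sub_mem
        (half_smul_mem_egfSubring hp (mul_mem (pow_mem hE _) hE)) (pow_mem hE _) n)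
  · rw [smul_smul, mul_inv_cancel₀ hp0, one_smul]
    ring

/-- Substituting `E ^ (m * p) = 1 + p * g` into the formula for the derivative of `E ^ (m * p)`
determines its coefficients modulo `p ^ 2`. The case `n = 0` is excluded because the constant `1`
contributes to it. -/
theorem exists_egfCoeff_succ_eulerSeries_pow (hp : Odd p) (m : ℕ) {n : ℕ} (hn : n ≠ 0) :
    ∃ r ∈ pIntegers p, egfCoeff (n + 1) (eulerSeries ^ (m * p)) =
      p * (m * egfCoeff n eulerSeries / 2 + p * r) := by
  obtain ⟨g, hg, h⟩ := exists_eulerSeries_pow_eq hp m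
  have hE := eulerSeries_mem_egfSubring hp
  refine ⟨m * egfCoeff n ((1 / 2 : ℚ) • (g * eulerSeries) - g),
    mul_mem (natCast_mem _ _) (sub_mem (half_smul_mem_egfSubring hp (mul_mem hg hE)) hg n), ?_⟩
  rw [← egfCoeff_derivative, derivative_eulerSeries_pow, h, add_mul, one_mul, smul_mul_assoc]
  simp only [map_smul, map_sub, map_add, egfCoeff_one, if_neg hn, smul_eq_mul]
  push_cast
  ring

/-- The constant term of `E_{mp}^{(mp)}` is `-p (2 ^ m - 1) B_m` modulo `p ^ 2`. -/
theorem exists_egfCoeff_mul_prime (hp : Odd p) {m : ℕ} (hm : 2 ≤ m) :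
    ∃ r ∈ pIntegers p, egfCoeff (m * p) (eulerSeries ^ (m * p)) =
      p * (p * r - (2 ^ m - 1) * _root_.bernoulli m) := by
  obtain ⟨n, rfl⟩ : ∃ n, m = n + 1 := ⟨m - 1, by omega⟩
  have hp1 : 1 ≤ p := (Fact.out : p.Prime).one_lt.le
  obtain ⟨r, hr, h⟩ := exists_egfCoeff_succ_eulerSeries_pow hp (n + 1)
    (n := n + (n + 1) * (p - 1)) (by omega)
  obtain ⟨s, hs, h'⟩ := exists_egfCoeff_eulerSeries_add_mul hp (n := n) (by omega) (n + 1)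
  have hidx : (n + 1) * p = n + (n + 1) * (p - 1) + 1 := by
    obtain ⟨q, rfl⟩ : ∃ q, p = q + 1 := ⟨p - 1, by omega⟩
    simp only [Nat.add_sub_cancel]
    ring
  refine ⟨(n + 1 : ℕ) * s * (1 / 2) + r,
    add_mem (mul_mem (mul_mem (natCast_mem _ _) hs) (half_mem_pIntegers hp)) hr, ?_⟩
  rw [← hidx] at h
  rw [h, h']
  linear_combination (p : ℚ) / 2 * succ_mul_egfCoeff_eulerSeries n

theorem isEisensteinForm_genEulerPoly_iff (hp : Odd p) {m : ℕ} (hm : 2 ≤ m) :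
    IsEisensteinForm p (genEulerPoly (m * p) (m * p)) ↔
      Rat.padicValuation p (m * (2 ^ m - 1) * _root_.bernoulli m) = 1 := by
  set b : ℚ := (2 ^ m - 1) * _root_.bernoulli m with hb
  obtain ⟨r, hr, h0⟩ := exists_egfCoeff_mul_prime hp hm
  have hlower : ∀ j < m * p, (genEulerPoly (m * p) (m * p)).coeff j = 0 ∨
      1 ≤ padicValRat p ((genEulerPoly (m * p) (m * p)).coeff j) := by
    intro j hj
    obtain ⟨g, hg, h⟩ := exists_eulerSeries_pow_eq hp m
    rw [coeff_genEulerPoly, if_pos hj.le, h, map_add, egfCoeff_one, if_neg (by omega), map_smul,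
      zero_add, smul_eq_mul, mul_left_comm]
    exact eq_zero_or_one_le_padicValRat (mul_mem (natCast_mem _ _) (hg _))
  have hconst : padicValRat p ((genEulerPoly (m * p) (m * p)).coeff 0) = 1 ↔
      Rat.padicValuation p b = 1 := by
    rw [coeff_genEulerPoly, if_pos (Nat.zero_le _), Nat.choose_zero_right, Nat.sub_zero, h0,
      Nat.cast_one, one_mul, padicValRat_prime_mul_eq_one_iff, ← hb]
    have hlt := padicValuation_prime_mul_lt_one hr
    constructor <;> intro h
    · rw [show b = p * r - (p * r - b) by ring, Valuation.map_sub_eq_of_lt_right _ (by rwa [h]), h]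
    · rw [Valuation.map_sub_eq_of_lt_right _ (by rwa [h]), h]
  have hm1 : Rat.padicValuation p m ≤ 1 := natCast_mem (pIntegers p) m
  have hb' : b = m * (-(1 / 2) * egfCoeff (m - 1) eulerSeries) := by
    have := succ_mul_egfCoeff_eulerSeries (m - 1)
    rw [Nat.sub_add_cancel (by omega)] at this
    rw [hb]
    linear_combination (1 / 2 : ℚ) * this
  have hc : Rat.padicValuation p (-(1 / 2) * egfCoeff (m - 1) eulerSeries) ≤ 1 :=
    mul_mem (neg_mem (half_mem_pIntegers hp)) (eulerSeries_mem_egfSubring hp (m - 1))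
  -- A common factor `p` of `m` also divides `b`, so multiplying `b` by `m` is harmless.
  have hbm : Rat.padicValuation p b ≤ Rat.padicValuation p m := by
    rw [hb', map_mul]
    exact mul_le_of_le_one_right' hc
  rw [IsEisensteinForm, leadingCoeff, natDegree_genEulerPoly, coeff_genEulerPoly_self, hconst,
    mul_assoc, ← hb, map_mul (Rat.padicValuation p) (m : ℚ) b]
  constructor
  · rintro ⟨-, -, h⟩
    rw [h, mul_one]
    exact le_antisymm hm1 (h ▸ hbm)
  · intro h
    refine ⟨padicValRat.one, hlower, le_antisymm (hbm.trans hm1) ?_⟩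
    rw [← h]
    exact mul_le_of_le_one_left' hm1

end Valuation

/-! ### Integrality of `m (2 ^ m - 1) B_m` -/

theorem exists_int_eq_mul_two_pow_sub_one_mul_bernoulli {m : ℕ} (hm : Even m) :
    ∃ N : ℤ, (N : ℚ) = (m : ℚ) * ((2 : ℚ) ^ m - 1) * _root_.bernoulli m := by
  obtain ⟨k, rfl⟩ := hm.exists_two_nsmul
  rw [smul_eq_mul]
  obtain ⟨z, hz⟩ := Bernoulli.vonStaudt_clausen k
  have hdvd : ∀ q ∈ (Finset.range (2 * k + 2)).filter fun q => q.Prime ∧ (q - 1) ∣ 2 * k,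
      (q : ℤ) ∣ (2 * k : ℕ) * (2 ^ (2 * k) - 1) := by
    intro q hq
    obtain ⟨-, hq, d, hd⟩ := Finset.mem_filter.1 hq
    have := Fact.mk hq
    rcases eq_or_ne q 2 with rfl | h2
    · exact Dvd.dvd.mul_right (by exact_mod_cast dvd_mul_right 2 k) _
    · refine Dvd.dvd.mul_left ?_ _
      rw [← ZMod.intCast_zmod_eq_zero_iff_dvd, hd]
      have h : (2 : ZMod q) ≠ 0 := fun h => h2 <| (Nat.prime_dvd_prime_iff_eq hq Nat.prime_two).1 <|
        (ZMod.natCast_eq_zero_iff 2 q).1 (by exact_mod_cast h)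
      push_cast
      rw [pow_mul, ZMod.pow_card_sub_one_eq_one h, one_pow, sub_self]
  refine ⟨((2 * k : ℕ) : ℤ) * (2 ^ (2 * k) - 1) * z - ∑ q ∈ (Finset.range (2 * k + 2)).filter
    fun q => q.Prime ∧ (q - 1) ∣ 2 * k, ((2 * k : ℕ) : ℤ) * (2 ^ (2 * k) - 1) / (q : ℤ), ?_⟩
  rw [eq_sub_of_add_eq hz.symm, Int.cast_sub, Int.cast_sum, mul_sub _ (z : ℚ), Finset.mul_sum]
  congr 1
  · push_cast
    ring
  · refine Finset.sum_congr rfl fun q hq => ?_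
    have hq0 : ((q : ℤ) : ℚ) ≠ 0 := by
      exact_mod_cast (Finset.mem_filter.1 hq).2.1.ne_zero
    rw [Int.cast_div (hdvd q hq) hq0]
    push_cast
    ring

theorem theorem1 (m p : ℕ) (hm : 0 < m) (hm_even : Even m) (hp : p.Prime) (hp_odd : Odd p) :
    ∃ N : ℤ, (N : ℚ) = (m : ℚ) * ((2 : ℚ) ^ m - 1) * _root_.bernoulli m ∧
      (IsEisensteinForm p (genEulerPoly (m * p) (m * p)) ↔ ¬ (p : ℤ) ∣ N) := by
  have := Fact.mk hp
  obtain ⟨N, hN⟩ := exists_int_eq_mul_two_pow_sub_one_mul_bernoulli hm_even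
  refine ⟨N, hN, ?_⟩
  rw [isEisensteinForm_genEulerPoly_iff hp_odd (by obtain ⟨k, hk⟩ := hm_even; omega), ← hN,
    Rat.padicValuation_cast, Int.padicValuation_eq_one_iff]
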